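/- \textbf{Setting.} Let $X$ be an infinite set and let $b:X\times X\to[0,\infty)$ be a connected graph over $X$: $b$ is symmetric, $b(x,x)=0$ and $\sum_{y}b(x,y)<\infty$ for all $x$, and any two vertices are joined by a finite path along which $b>0$. Let $q:X\to\mathbb R$ and $o\in X$. A function $f$ on $X$ is called positive if $f\ge 0$ and $f\ne 0$. Let $C_c(X)$ be the space of finitely supported real functions on $X$. On $F(X)=\{f:X\to\mathbb R \mid \sum_y b(x,y)|f(y)|<\infty \text{ for all } x\}$ put $Hf(x)=\sum_{y}b(x,y)(f(x)-f(y))+q(x)f(x)$, and on $C_c(X)$ let $$h(\varphi,\eta)=\tfrac12\sum_{x,y}b(x,y)(\varphi(x)-\varphi(y))(\eta(x)-\eta(y))+\sum_x q(x)\varphi(x)\eta(x),\qquad h(\varphi)=h(\varphi,\varphi).$$ For $w:X\to\mathbb R$ the form $h-w$, $(h-w)(\varphi)=h(\varphi)-\sum_x w(x)\varphi(x)^2$, and the operator $H-w$ are those with potential $q-w$ in place of $q$. A form $h\ge 0$ on $C_c(X)$ is subcritical if $h-w'\ge0$ on $C_c(X)$ for some positive $w'$, and critical otherwise. The ground state of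 a critical form $h$ normalized at $o$ is the (unique) positive $\psi\in F(X)$ with $H\psi=0$ and $\psi(o)=1$. A form is positive-critical with respect to a positive function $w$ if it is critical and its ground state $\psi$ satisfies $\sum_x w(x)\psi(x)^2<\infty$. For positive $w$ write $\|f\|_w=(\sum_x w(x)f(x)^2)^{1/2}$ and $\ell^2(X,w)=\{f:X\to\mathbb R\mid\|f\|_w<\infty\}$. If $h\ge 0$, the extended space $D_{h,o}$ is the completion of $C_c(X)$ with respect to $\|\varphi\|_{h,o}=(h(\varphi)+\varphi(o)^2)^{1/2}$, realized as a space of functions on $X$ through pointwise limits of Cauchy sequences, and $\overline h(f)=\lim_n h(\varphi_n)$ if $(\varphi_n)$ in $C_c(X)$ converges to $f$ in $D_{h,o}$. If $h\ge0$ and $m:X\to(0,\infty)$, then $h^{(m)}$ is the closure of $h$ in $\ell^2(X,m)$, and $H^{(m)}$ is the associated self-adjoint operator: $f\in D(H^{(m)})$ and $H^{(m)}f=g$ if and only if $f\in D(h^{(m)})$, $g\in\ell^2(X,m)$ and $h^{(m)}(f,k)=\sum_x g(x)k(x)m(x)$ for all $k\in D(h^{(m)})$. \textbf{Theorem (Positive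 criticality).} Let $w$ be positive such that $h-w\ge0$ on $C_c(X)$ and $h-w$ is critical, and let $\psi$ be the ground state of $h-w$ normalized at $o$. Then the following are equivalent: \begin{itemize} \item[(i)] $h-w$ is positive-critical with respect to $w$, that is, $\psi\in\ell^2(X,w)$. \item[(ii)] $\psi\in D_{h,o}$. \item[(iii)] $\psi\in D_{h,o}\cap\ell^2(X,w)$. \item[(iv)] There is $v\in D_{h,o}\cap\ell^2(X,w)$ with $\|v\|_w\neq0$ such that $$\frac{\overline h(v)}{\|v\|_w^2}=\inf\Big\{\frac{h(\varphi)}{\|\varphi\|_w^2}\ \Big|\ \varphi\in C_c(X),\ \|\varphi\|_w\ne0\Big\}.$$ \item[(v)] $\psi\in D_{h,o}\cap\ell^2(X,w)$, $\|\psi\|_w\ne 0$, and $$\frac{\overline h(\psi)}{\|\psi\|_w^2}=\inf\Big\{\frac{h(\varphi)}{\|\varphi\|_w^2}\ \Big|\ \varphi\in C_c(X),\ \|\varphi\|_w\ne0\Big\}.$$ \end{itemize} If, furthermore, $w(x)>0$ for all $x\in X$, then these are also equivalent to \begin{itemize} \item[(vi)] $\psi$ is an eigenfunction of the operator $(H-w)^{(w)}$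 with eigenvalue $0$. \end{itemize} -/

import Mathlib

open Filter Topology

noncomputable section

namespace GraphCriticality

/-- A graph over `X`: a symmetric, nonnegative, locally summable edge weight with zero diagonal. -/
structure WGraph (X : Type*) where
  b : X → X → ℝ
  nonneg : ∀ x y, 0 ≤ b x y
  symm : ∀ x y, b x y = b y x
  diag : ∀ x, b x x = 0
  summable : ∀ x, Summable (fun y => b x y)

variable {X : Type*}

/-- Two vertices are adjacent if the edge weight between them is positive. -/
def WGraph.Adj (G : WGraph X) (x y : X) : Prop := 0 < G.b x y

/-- Any two vertices are joined by a finite path of successively adjacent vertices. -/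
def WGraph.Connected (G : WGraph X) : Prop :=
  ∀ x y, Relation.ReflTransGen G.Adj x y

/-- `f` is positive: `f ≥ 0` and `f ≠ 0`. -/
def IsPositive (f : X → ℝ) : Prop := (∀ x, 0 ≤ f x) ∧ f ≠ 0

/-- The domain `F(X)` of the formal operators. -/
def formalDomain (G : WGraph X) : Set (X → ℝ) :=
  {f | ∀ x, Summable (fun y => G.b x y * |f y|)}

/-- The formal Schrödinger operator `H = L + q`. -/
def formalOp (G : WGraph X) (q : X → ℝ) (f : X → ℝ) (x : X) : ℝ :=
  (∑' y, G.b x y * (f x - f y)) + q x * f x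

/-- The bilinear form `h` on `C_c(X)`, the finitely supported functions. -/
def form (G : WGraph X) (q : X → ℝ) (φ η : X →₀ ℝ) : ℝ :=
  (1 / 2) * (∑' p : X × X, G.b p.1 p.2 * (φ p.1 - φ p.2) * (η p.1 - η p.2))
    + ∑' x, q x * φ x * η x

/-- The quadratic form of `h` on `C_c(X)`. -/
def quadForm (G : WGraph X) (q : X → ℝ) (φ : X →₀ ℝ) : ℝ := form G q φ φ

/-- `h ≥ 0` on `C_c(X)`. -/
def FormNonneg (G : WGraph X) (q : X → ℝ) : Prop := ∀ φ : X →₀ ℝ, 0 ≤ quadForm G q φ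

/-- The nonnegative form `h` is subcritical: there is a positive `w` with `h - w ≥ 0`.
The form `h - w` is the form with potential `q - w`. -/
def IsSubcritical (G : WGraph X) (q : X → ℝ) : Prop :=
  FormNonneg G q ∧ ∃ w : X → ℝ, IsPositive w ∧ FormNonneg G (q - w)

/-- The form `h` is nonnegative and critical. -/
def IsCritical (G : WGraph X) (q : X → ℝ) : Prop :=
  FormNonneg G q ∧ ¬ IsSubcritical G q

/-- `ψ` is a ground state of `h` normalized at `o`: a positive `H`-harmonic function with
`ψ o = 1` (it exists and is unique if the graph is connected and `h` is critical). -/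
def IsGroundState (G : WGraph X) (q : X → ℝ) (o : X) (ψ : X → ℝ) : Prop :=
  IsPositive ψ ∧ ψ ∈ formalDomain G ∧ (∀ x, formalOp G q ψ x = 0) ∧ ψ o = 1

/-- The functions that are square summable with respect to the weight `w ≥ 0`. -/
def ellTwo (w : X → ℝ) : Set (X → ℝ) := {f | Summable (fun x => w x * f x ^ 2)}

/-- The (semi-)norm of `ℓ²(X,w)`. -/
def normW (w f : X → ℝ) : ℝ := Real.sqrt (∑' x, w x * f x ^ 2)

/-- The (semi-)scalar product of `ℓ²(X,w)`. -/
def innerW (w f g : X → ℝ) : ℝ := ∑' x, f x * g x * w x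

/-- `h` is positive-critical with respect to `w`: it is critical and its ground state
(with any normalization) is square summable with weight `w`. -/
def IsPositiveCritical (G : WGraph X) (q w : X → ℝ) : Prop :=
  IsCritical G q ∧ ∃ (o : X) (ψ : X → ℝ), IsGroundState G q o ψ ∧ ψ ∈ ellTwo w

/-- A sequence in `C_c(X)` is Cauchy with respect to the (semi-)norm `N`. -/
def IsCauchyFor (N : (X →₀ ℝ) → ℝ) (φ : ℕ → X →₀ ℝ) : Prop :=
  ∀ ε > 0, ∃ n₀, ∀ m ≥ n₀, ∀ n ≥ n₀, N (φ m - φ n) < ε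

/-! The extended space -/

/-- The norm `‖φ‖_{h,o}`. -/
def normO (G : WGraph X) (q : X → ℝ) (o : X) (φ : X →₀ ℝ) : ℝ :=
  Real.sqrt (quadForm G q φ + φ o ^ 2)

/-- `φ` represents the element `f` of the completion of `C_c(X)` with respect to `‖·‖_{h,o}`.
The completion is a space of functions since convergence in this norm implies
pointwise convergence. -/
def ExtApprox (G : WGraph X) (q : X → ℝ) (o : X) (φ : ℕ → X →₀ ℝ) (f : X → ℝ) : Prop :=
  IsCauchyFor (normO G q o) φ ∧ ∀ x, Tendsto (fun n => φ n x) atTop (𝓝 (f x))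

/-- The extended space `D_{h,o}`. -/
def extSpace (G : WGraph X) (q : X → ℝ) (o : X) : Set (X → ℝ) :=
  {f | ∃ φ, ExtApprox G q o φ f}

open Classical in
/-- The closure of `h` on `D_{h,o}`: the limit of `h(φ n)` along an approximating
sequence (for `h ≥ 0` on a connected graph the limit exists and does not depend on the
sequence); `0` outside `D_{h,o}`. -/
def extForm (G : WGraph X) (q : X → ℝ) (o : X) (f : X → ℝ) : ℝ :=
  if hf : ∃ φ, ExtApprox G q o φ f then
    limUnder atTop (fun n => quadForm G q (hf.choose n))
  else 0

/-- The values of the Rayleigh quotient `h(φ) / ‖φ‖_w²` on `C_c(X)`, where `‖φ‖_w ≠ 0`. -/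
def rayleighSet (G : WGraph X) (q w : X → ℝ) : Set ℝ :=
  {r | ∃ φ : X →₀ ℝ, normW w φ ≠ 0 ∧ r = quadForm G q φ / normW w φ ^ 2}

/-- `v ∈ D_{h,o} ∩ ℓ²(X,w)`, its Rayleigh quotient is defined, and it equals the infimum of
the Rayleigh quotients on `C_c(X)`. -/
def AttainsRayleigh (G : WGraph X) (q w : X → ℝ) (o : X) (v : X → ℝ) : Prop :=
  v ∈ extSpace G q o ∩ ellTwo w ∧ normW w v ≠ 0 ∧
    IsGLB (rayleighSet G q w) (extForm G q o v / normW w v ^ 2)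

/-! The closure of `h` in `ℓ²(X,m)` and the associated operator, for `m > 0` -/

/-- The form norm `‖φ‖_{h,m}`. -/
def normF (G : WGraph X) (q m : X → ℝ) (φ : X →₀ ℝ) : ℝ :=
  Real.sqrt (quadForm G q φ + normW m φ ^ 2)

/-- `φ` is Cauchy in the form norm and converges to `f` in `ℓ²(X,m)`. -/
def FormApprox (G : WGraph X) (q m : X → ℝ) (φ : ℕ → X →₀ ℝ) (f : X → ℝ) : Prop :=
  f ∈ ellTwo m ∧ IsCauchyFor (normF G q m) φ ∧
    Tendsto (fun n => normW m (⇑(φ n) - f)) atTop (𝓝 0)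

/-- The domain of the closure `h^{(m)}`. -/
def closureDomain (G : WGraph X) (q m : X → ℝ) : Set (X → ℝ) :=
  {f | ∃ φ, FormApprox G q m φ f}

open Classical in
/-- The closure `h^{(m)}` as a bilinear form: the limit of `h(φ n, η n)` along approximating
sequences; `0` outside the domain. -/
def closureForm (G : WGraph X) (q m f g : X → ℝ) : ℝ :=
  if hfg : (∃ φ, FormApprox G q m φ f) ∧ (∃ η, FormApprox G q m η g) then
    limUnder atTop (fun n => form G q (hfg.1.choose n) (hfg.2.choose n))
  else 0

/-- `f ∈ D(H^{(m)})` and `H^{(m)} f = g`. -/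
def OperatorRel (G : WGraph X) (q m f g : X → ℝ) : Prop :=
  f ∈ closureDomain G q m ∧ g ∈ ellTwo m ∧
    ∀ k ∈ closureDomain G q m, closureForm G q m f k = innerW m g k

/-- `f` is an eigenfunction of `H^{(m)}` with eigenvalue `c`. -/
def IsEigenfunction (G : WGraph X) (q m : X → ℝ) (c : ℝ) (f : X → ℝ) : Prop :=
  f ≠ 0 ∧ OperatorRel G q m f (c • f)

end GraphCriticality

end

/-! Dividing by the ground state turns `h - w` into a square norm: `(h - w)(φ)` is the `ℓ²` norm
squared of the edge function `edgeDiff G ψ φ` (`hasSum_edgeDiff_mul`). Hence `h(φ)` splits into this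
edge part plus `‖φ‖_w²`, and the split passes to limits of `h`-Cauchy sequences (`extForm_eq`). The
edge part vanishes exactly on multiples of `ψ`.

So `D_{h,o}` always lies in `ℓ²(X,w)`. For the converse, criticality gives `e n` with `e n o = 1`,
`0 ≤ e n ≤ ψ` and `(h - w)(e n) → 0`, which forces `e n → ψ` pointwise
(`IsCritical.exists_null_sequence`). If `ψ ∈ ℓ²(X,w)`, dominated convergence makes `e n` Cauchy for
`h` (`quadForm_cauchy_of_null`). This puts `ψ` in `D_{h,o}` and in the domain of the closure of `h -
w`, where its edge part is zero. The Rayleigh infimum is 1 (`isGLB_rayleighSet`), so a minimizer has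
zero edge part and is a multiple of `ψ`. -/

namespace GraphCriticality

noncomputable section

/-! ### Limits of Cauchy sequences in `ℓ²` -/

section SquareSummable

variable {ι : Type*}

/-- A sequence of square summable functions that is Cauchy in `ℓ²`. -/
def IsSqCauchy (f : ℕ → ι → ℝ) : Prop :=
  (∀ n, Summable fun i => f n i ^ 2) ∧
    ∀ ε > 0, ∃ N, ∀ m ≥ N, ∀ n ≥ N, ∑' i, (f m i - f n i) ^ 2 < ε

theorem memlp_two_of_summable_sq {f : ι → ℝ} (hf : Summable fun i => f i ^ 2) :
    Memℓp (E := fun _ : ι => ℝ) f 2 := by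
  apply memℓp_gen
  simpa using hf

theorem lp_two_norm_sq (f : lp (fun _ : ι => ℝ) 2) : ‖f‖ ^ 2 = ∑' i, f i ^ 2 := by
  have h := lp.norm_rpow_eq_tsum (p := 2) (by norm_num) f
  simpa using h

/-- Completeness of `ℓ²` supplies the limit; evaluation at a point is bounded by the norm, so the
limit must be `g`. -/
theorem IsSqCauchy.exists_lp_tendsto {f : ℕ → ι → ℝ} {g : ι → ℝ} (hf : IsSqCauchy f)
    (hg : ∀ i, Tendsto (fun n => f n i) atTop (𝓝 (g i))) :
    ∃ (F : ℕ → lp (fun _ : ι => ℝ) 2) (L : lp (fun _ : ι => ℝ) 2),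
      (∀ n i, F n i = f n i) ∧ (∀ i, L i = g i) ∧ Tendsto F atTop (𝓝 L) := by
  let F : ℕ → lp (fun _ : ι => ℝ) 2 := fun n => ⟨f n, memlp_two_of_summable_sq (hf.1 n)⟩
  have hF : CauchySeq F := by
    rw [Metric.cauchySeq_iff]
    intro ε hε
    obtain ⟨N, hN⟩ := hf.2 (ε ^ 2) (by positivity)
    refine ⟨N, fun m hm n hn => ?_⟩
    rw [dist_eq_norm]
    refine lt_of_pow_lt_pow_left₀ 2 hε.le ?_
    rw [lp_two_norm_sq]
    exact hN m hm n hn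
  obtain ⟨L, hL⟩ := cauchySeq_tendsto_of_complete hF
  refine ⟨F, L, fun _ _ => rfl, fun i => ?_, hL⟩
  refine tendsto_nhds_unique ?_ (hg i)
  have h : Tendsto (fun n => F n i - L i) atTop (𝓝 0) := by
    refine squeeze_zero_norm (fun n => ?_) (tendsto_iff_norm_sub_tendsto_zero.mp hL)
    exact lp.norm_apply_le_norm (by norm_num) (F n - L) i
  simpa using h.add_const (L i)

theorem IsSqCauchy.summable_sq {f : ℕ → ι → ℝ} {g : ι → ℝ} (hf : IsSqCauchy f)
    (hg : ∀ i, Tendsto (fun n => f n i) atTop (𝓝 (g i))) : Summable fun i => g i ^ 2 := by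
  obtain ⟨F, L, -, hL, -⟩ := hf.exists_lp_tendsto hg
  have h := (lp.memℓp L).summable (by norm_num)
  simpa [hL] using h

theorem IsSqCauchy.tendsto_tsum_mul {f f' : ℕ → ι → ℝ} {g g' : ι → ℝ} (hf : IsSqCauchy f)
    (hf' : IsSqCauchy f') (hg : ∀ i, Tendsto (fun n => f n i) atTop (𝓝 (g i)))
    (hg' : ∀ i, Tendsto (fun n => f' n i) atTop (𝓝 (g' i))) :
    Tendsto (fun n => ∑' i, f n i * f' n i) atTop (𝓝 (∑' i, g i * g' i)) := by
  obtain ⟨F, L, hF, hL, hFL⟩ := hf.exists_lp_tendsto hg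
  obtain ⟨F', L', hF', hL', hFL'⟩ := hf'.exists_lp_tendsto hg'
  have h := hFL'.inner (𝕜 := ℝ) hFL
  simpa [lp.inner_eq_tsum, hF, hF', hL, hL'] using h

end SquareSummable

/-! ### Edge sums and the ground state representation -/

variable {X : Type*} {G : WGraph X} {q w ψ : X → ℝ} {o : X}

/-- Each row is absolutely summable by `hc`, and only finitely many rows are nonzero. -/
theorem summable_edge_mul {c : X → ℝ} (hc : c ∈ formalDomain G) (u : X →₀ ℝ) :
    Summable fun p : X × X => G.b p.1 p.2 * u p.1 * c p.2 := by
  rw [← summable_abs_iff]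
  refine (summable_prod_of_nonneg fun p => abs_nonneg _).2 ⟨fun x => ?_, ?_⟩
  · refine ((hc x).mul_left |u x|).congr fun y => ?_
    simp only [abs_mul, abs_of_nonneg (G.nonneg x y)]
    ring
  · refine summable_of_hasFiniteSupport (u.support.finite_toSet.subset fun x hx => ?_)
    simp only [Function.mem_support, Finset.mem_coe, Finsupp.mem_support_iff] at hx ⊢
    intro h
    simp [h] at hx

theorem one_mem_formalDomain : (fun _ => 1) ∈ formalDomain G := fun x => by
  simpa using G.summable x

theorem finsupp_mem_formalDomain (φ : X →₀ ℝ) : (φ : X → ℝ) ∈ formalDomain G := fun x => by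
  refine summable_of_hasFiniteSupport (φ.support.finite_toSet.subset fun y hy => ?_)
  simp only [Function.mem_support, Finset.mem_coe, Finsupp.mem_support_iff] at hy ⊢
  intro h
  simp [h] at hy

theorem summable_swap {f : X × X → ℝ} (hf : Summable f) : Summable fun p : X × X => f p.swap :=
  (Equiv.prodComm X X).summable_iff.2 hf

/-- The pointwise product of finitely supported functions and an arbitrary factor. -/
def mulFactor (φ η : X →₀ ℝ) (k : X → ℝ) : X →₀ ℝ :=
  Finsupp.onFinset φ.support (fun x => φ x * η x * k x) fun x hx => by
    simp only [Finsupp.mem_support_iff]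
    intro h
    simp [h] at hx

@[simp] theorem mulFactor_apply (φ η : X →₀ ℝ) (k : X → ℝ) (x : X) :
    mulFactor φ η k x = φ x * η x * k x := rfl

theorem summable_form (φ η : X →₀ ℝ) :
    Summable fun p : X × X => G.b p.1 p.2 * (φ p.1 - φ p.2) * (η p.1 - η p.2) := by
  have h1 := summable_edge_mul (G := G) one_mem_formalDomain (mulFactor φ η 1)
  have h2 := summable_edge_mul (G := G) (finsupp_mem_formalDomain η) φ
  refine ((h1.add (summable_swap h1)).sub (h2.add (summable_swap h2))).congr fun p => ?_
  simp only [mulFactor_apply, Prod.fst_swap, Prod.snd_swap, Pi.one_apply, G.symm p.2 p.1]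
  ring

/-- At a zero `y`, harmonicity reads `∑ b(y,z) ψ(z) = 0`, so all neighbours are zeros. By
connectedness the zeros would reach `o`, where `ψ = 1`. -/
theorem IsGroundState.pos (hG : G.Connected) (hψ : IsGroundState G q o ψ) (x : X) : 0 < ψ x := by
  obtain ⟨⟨h0, -⟩, hF, hH, h1⟩ := hψ
  refine lt_of_le_of_ne (h0 x) fun hx => ?_
  have key : ∀ y, ψ y = 0 → ∀ z, G.Adj y z → ψ z = 0 := by
    intro y hy z hyz
    have h := hH y
    simp only [formalOp, hy, mul_zero, add_zero, zero_sub, mul_neg, tsum_neg, neg_eq_zero] at h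
    have hs : Summable fun z => G.b y z * ψ z :=
      (hF y).congr fun z => by rw [abs_of_nonneg (h0 z)]
    have h2 := (hs.hasSum_iff.2 h)
    rw [hasSum_zero_iff_of_nonneg fun z => mul_nonneg (G.nonneg y z) (h0 z)] at h2
    exact (mul_eq_zero.1 (congrFun h2 z)).resolve_left hyz.ne'
  have : ∀ z, ψ z = 0 := by
    intro z
    induction hG x z with
    | refl => exact hx.symm
    | tail _ hyz ih => exact key _ ih _ hyz
  linarith [this o]

/-- The weighted difference along an edge of the quotient of `f` by `ψ`. -/
def edgeDiff (G : WGraph X) (ψ f : X → ℝ) (p : X × X) : ℝ :=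
  √(G.b p.1 p.2 * ψ p.1 * ψ p.2 / 2) * (f p.1 / ψ p.1 - f p.2 / ψ p.2)

theorem edgeDiff_sub (f g : X → ℝ) (p : X × X) :
    edgeDiff G ψ (f - g) p = edgeDiff G ψ f p - edgeDiff G ψ g p := by
  simp only [edgeDiff, Pi.sub_apply]
  ring

theorem edgeDiff_mul (hψ : ∀ x, 0 < ψ x) (f g : X → ℝ) (p : X × X) :
    edgeDiff G ψ f p * edgeDiff G ψ g p = G.b p.1 p.2 * ψ p.1 * ψ p.2 / 2 *
      ((f p.1 / ψ p.1 - f p.2 / ψ p.2) * (g p.1 / ψ p.1 - g p.2 / ψ p.2)) := by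
  have h : 0 ≤ G.b p.1 p.2 * ψ p.1 * ψ p.2 / 2 :=
    div_nonneg (mul_nonneg (mul_nonneg (G.nonneg _ _) (hψ _).le) (hψ _).le) (by norm_num)
  rw [edgeDiff, edgeDiff, mul_mul_mul_comm, Real.mul_self_sqrt h]

/-- The ground state representation of the form. -/
theorem hasSum_edgeDiff_mul (hψ : ∀ x, 0 < ψ x) (hF : ψ ∈ formalDomain G)
    (hH : ∀ x, formalOp G q ψ x = 0) (φ η : X →₀ ℝ) :
    HasSum (fun p => edgeDiff G ψ φ p * edgeDiff G ψ η p) (form G q φ η) := by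
  -- Testing harmonicity of `ψ` against `u = φη/ψ` turns the potential term into an edge sum. Adding
  -- its image under the swap of endpoints makes it match the form edge by edge.
  set u := mulFactor φ η (fun x => (ψ x)⁻¹)
  set v := mulFactor φ η 1
  have hs : Summable fun p : X × X => G.b p.1 p.2 * v p.1 - G.b p.1 p.2 * u p.1 * ψ p.2 :=
    ((summable_edge_mul (G := G) one_mem_formalDomain v).congr fun p => by ring).sub
      (summable_edge_mul hF u)
  have hsum : ∑' p : X × X, (G.b p.1 p.2 * v p.1 - G.b p.1 p.2 * u p.1 * ψ p.2)
      = -∑' x, q x * φ x * η x := by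
    rw [hs.tsum_prod, ← tsum_neg]
    refine tsum_congr fun x => ?_
    have h := hH x
    rw [formalOp] at h
    have h2 : ∀ y, G.b x y * v x - G.b x y * u x * ψ y = u x * (G.b x y * (ψ x - ψ y)) := by
      intro y
      have := (hψ x).ne'
      simp only [u, v, mulFactor_apply, Pi.one_apply]
      field_simp
    rw [tsum_congr h2, tsum_mul_left, eq_neg_of_add_eq_zero_left h]
    have := (hψ x).ne'
    simp only [u, mulFactor_apply]
    field_simp
  have h1 := hs.hasSum
  rw [hsum] at h1
  have h2 : HasSum (fun p : X × X => G.b p.2 p.1 * v p.2 - G.b p.2 p.1 * u p.2 * ψ p.1) _ :=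
    (Equiv.prodComm X X).hasSum_iff.2 h1
  have h3 := (((summable_form (G := G) φ η).hasSum).sub (h1.add h2)).mul_left (1 / 2)
  have hfun : ∀ p : X × X, edgeDiff G ψ φ p * edgeDiff G ψ η p = 1 / 2 *
      (G.b p.1 p.2 * (φ p.1 - φ p.2) * (η p.1 - η p.2) -
        (G.b p.1 p.2 * v p.1 - G.b p.1 p.2 * u p.1 * ψ p.2 +
          (G.b p.2 p.1 * v p.2 - G.b p.2 p.1 * u p.2 * ψ p.1))) := fun p => by
    rw [edgeDiff_mul hψ]
    have := (hψ p.1).ne'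
    have := (hψ p.2).ne'
    simp only [u, v, mulFactor_apply, Pi.one_apply, G.symm p.2 p.1]
    field_simp
    ring
  have hval : form G q φ η = 1 / 2 *
      (∑' p : X × X, G.b p.1 p.2 * (φ p.1 - φ p.2) * (η p.1 - η p.2) -
        (-∑' x, q x * φ x * η x + -∑' x, q x * φ x * η x)) := by
    rw [form]
    ring
  rw [funext hfun, hval]
  exact h3

theorem hasSum_edgeDiff_sq (hψ : ∀ x, 0 < ψ x) (hF : ψ ∈ formalDomain G)
    (hH : ∀ x, formalOp G q ψ x = 0) (φ : X →₀ ℝ) :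
    HasSum (fun p => edgeDiff G ψ φ p ^ 2) (quadForm G q φ) := by
  simpa only [sq, quadForm] using hasSum_edgeDiff_mul hψ hF hH φ φ

theorem quadForm_sub_le (hψ : ∀ x, 0 < ψ x) (hF : ψ ∈ formalDomain G)
    (hH : ∀ x, formalOp G q ψ x = 0) (φ η : X →₀ ℝ) :
    quadForm G q (φ - η) ≤ 2 * quadForm G q φ + 2 * quadForm G q η := by
  have hrep := hasSum_edgeDiff_sq hψ hF hH
  refine hasSum_le (fun p => ?_) (hrep (φ - η)) (((hrep φ).mul_left 2).add ((hrep η).mul_left 2))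
  rw [Finsupp.coe_sub, edgeDiff_sub]
  nlinarith [sq_nonneg (edgeDiff G ψ φ p + edgeDiff G ψ η p)]

theorem summable_weight_sq (w : X → ℝ) (φ : X →₀ ℝ) : Summable fun x => w x * φ x ^ 2 := by
  refine summable_of_hasFiniteSupport (φ.support.finite_toSet.subset fun x hx => ?_)
  simp only [Function.mem_support, Finset.mem_coe, Finsupp.mem_support_iff] at hx ⊢
  intro h
  simp [h] at hx

theorem normW_sq (hw : ∀ x, 0 ≤ w x) (f : X → ℝ) : normW w f ^ 2 = ∑' x, w x * f x ^ 2 :=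
  Real.sq_sqrt (tsum_nonneg fun x => mul_nonneg (hw x) (sq_nonneg _))

theorem quadForm_eq_sub_add (q w : X → ℝ) (φ : X →₀ ℝ) :
    quadForm G q φ = quadForm G (q - w) φ + ∑' x, w x * φ x ^ 2 := by
  have h1 : Summable fun x => (q - w) x * φ x * φ x :=
    (summable_weight_sq (q - w) φ).congr fun x => by ring
  have h : ∑' x, q x * φ x * φ x
      = ∑' x, (q - w) x * φ x * φ x + ∑' x, w x * φ x ^ 2 := by
    rw [← h1.tsum_add (summable_weight_sq w φ)]
    refine tsum_congr fun x => ?_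
    simp only [Pi.sub_apply]
    ring
  rw [quadForm, quadForm, form, form, h]
  ring

/-! ### Propagation along paths -/

theorem eq_of_edgeDiff_eq_zero (hG : G.Connected) (hψ : ∀ x, 0 < ψ x) {f : X → ℝ}
    (hf : ∀ p, edgeDiff G ψ f p = 0) (x : X) : f x / ψ x = f o / ψ o := by
  induction hG o x with
  | refl => rfl
  | @tail y z _ hyz ih =>
    have hyz : 0 < G.b y z := hyz
    have h := hf (y, z)
    have h0 : 0 < √(G.b y z * ψ y * ψ z / 2) := by
      have := hψ y
      have := hψ z
      positivity
    have := (mul_eq_zero.1 h).resolve_left h0.ne'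
    linarith

/-- Across an edge, `f n / ψ` changes by `edgeDiff` over a fixed positive factor, so its limit at
`o` is carried along any path. -/
theorem tendsto_of_edgeDiff_tendsto_zero (hG : G.Connected) (hψ : ∀ x, 0 < ψ x)
    {f : ℕ → X → ℝ} (hf : ∀ p, Tendsto (fun n => edgeDiff G ψ (f n) p) atTop (𝓝 0))
    (ho : ∀ n, f n o = 1) (x : X) : Tendsto (fun n => f n x) atTop (𝓝 (ψ x / ψ o)) := by
  have key : Tendsto (fun n => f n x / ψ x) atTop (𝓝 (1 / ψ o)) := by
    induction hG o x with
    | refl => simp [ho]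
    | @tail y z _ hyz ih =>
      have hyz : 0 < G.b y z := hyz
      have h0 : 0 < √(G.b y z * ψ y * ψ z / 2) := by
        have := hψ y
        have := hψ z
        positivity
      have h := ih.sub ((hf (y, z)).div_const √(G.b y z * ψ y * ψ z / 2))
      rw [zero_div, sub_zero] at h
      refine h.congr fun n => ?_
      simp only [edgeDiff]
      rw [mul_div_cancel_left₀ _ h0.ne', sub_sub_cancel]
  have h := key.mul_const (ψ x)
  rw [one_div_mul_eq_div] at h
  exact h.congr fun n => div_mul_cancel₀ _ (hψ x).ne'

theorem tendsto_edgeDiff_of_tendsto {f : ℕ → X → ℝ} {g : X → ℝ}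
    (h : ∀ x, Tendsto (fun n => f n x) atTop (𝓝 (g x))) (p : X × X) :
    Tendsto (fun n => edgeDiff G ψ (f n) p) atTop (𝓝 (edgeDiff G ψ g p)) :=
  (((h p.1).div_const _).sub ((h p.2).div_const _)).const_mul _

theorem tendsto_edgeDiff_of_quadForm {e : ℕ → X →₀ ℝ} (hψ : ∀ x, 0 < ψ x)
    (hF : ψ ∈ formalDomain G) (hH : ∀ x, formalOp G q ψ x = 0)
    (he : Tendsto (fun n => quadForm G q (e n)) atTop (𝓝 0)) (p : X × X) :
    Tendsto (fun n => edgeDiff G ψ (e n) p) atTop (𝓝 0) := by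
  have h : Tendsto (fun n => edgeDiff G ψ (e n) p ^ 2) atTop (𝓝 0) :=
    squeeze_zero (fun n => sq_nonneg _) (fun n => le_hasSum (hasSum_edgeDiff_sq hψ hF hH (e n)) p
      fun _ _ => sq_nonneg _) he
  have h2 := (Real.continuous_sqrt.tendsto 0).comp h
  simp only [Function.comp_def, Real.sqrt_sq_eq_abs, Real.sqrt_zero] at h2
  exact (tendsto_zero_iff_abs_tendsto_zero _).2 h2

/-! ### Null sequences of critical forms -/

theorem quadForm_smul (c : ℝ) (φ : X →₀ ℝ) : quadForm G q (c • φ) = c ^ 2 * quadForm G q φ := by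
  have h1 : ∑' p : X × X, G.b p.1 p.2 * ((c • φ) p.1 - (c • φ) p.2) * ((c • φ) p.1 - (c • φ) p.2)
      = c ^ 2 * ∑' p : X × X, G.b p.1 p.2 * (φ p.1 - φ p.2) * (φ p.1 - φ p.2) := by
    rw [← tsum_mul_left]
    refine tsum_congr fun p => ?_
    simp only [Finsupp.smul_apply, smul_eq_mul]
    ring
  have h2 : ∑' x, q x * (c • φ) x * (c • φ) x = c ^ 2 * ∑' x, q x * φ x * φ x := by
    rw [← tsum_mul_left]
    refine tsum_congr fun x => ?_
    simp only [Finsupp.smul_apply, smul_eq_mul]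
    ring
  rw [quadForm, quadForm, form, form, h1, h2]
  ring

/-- A critical form is arbitrarily small on functions normalized at a vertex. -/
theorem IsCritical.exists_small (h : IsCritical G q) (o : X) {ε : ℝ} (hε : 0 < ε) :
    ∃ φ : X →₀ ℝ, φ o = 1 ∧ quadForm G q φ < ε := by
  classical
  by_contra! hcon
  -- Otherwise scaling gives `h(φ) ≥ ε φ(o)²` for all `φ`, so `ε` times the indicator of `o` could
  -- be subtracted.
  refine h.2 ⟨h.1, Pi.single o ε, ⟨fun x => ?_, fun h0 => ?_⟩, fun φ => ?_⟩
  · by_cases hx : x = o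
    · subst hx
      simp [hε.le]
    · simp [hx]
  · have := congrFun h0 o
    simp [hε.ne'] at this
  · have h1 := quadForm_eq_sub_add (G := G) q (Pi.single o ε) φ
    have h2 : ∑' x, (Pi.single o ε : X → ℝ) x * φ x ^ 2 = ε * φ o ^ 2 := by
      rw [tsum_eq_single o fun x hx => by simp [hx]]
      simp
    rw [h2] at h1
    by_cases h0 : φ o = 0
    · have := h.1 φ
      rw [h0] at h1
      linarith
    · have h3 := hcon ((φ o)⁻¹ • φ) (by simp [h0])
      rw [quadForm_smul, inv_pow, inv_mul_eq_div, le_div_iff₀ (by positivity)] at h3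
      linarith

/-- The truncation of `φ` to the interval between `0` and `ψ`. -/
def truncate (ψ : X → ℝ) (φ : X →₀ ℝ) : X →₀ ℝ :=
  Finsupp.onFinset φ.support (fun x => max 0 (min 1 (φ x / ψ x)) * ψ x) fun x hx => by
    simp only [Finsupp.mem_support_iff]
    intro h
    simp [h] at hx

theorem truncate_apply (φ : X →₀ ℝ) (x : X) :
    truncate ψ φ x = max 0 (min 1 (φ x / ψ x)) * ψ x := rfl

/-- Clamping `φ/ψ` to `[0,1]` is 1-Lipschitz, and `edgeDiff` only sees differences of this quotient.
-/
theorem edgeDiff_truncate_sq_le (hψ : ∀ x, 0 < ψ x) (φ : X →₀ ℝ) (p : X × X) :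
    edgeDiff G ψ (truncate ψ φ) p ^ 2 ≤ edgeDiff G ψ φ p ^ 2 := by
  simp only [edgeDiff, mul_pow, truncate_apply, mul_div_cancel_right₀ _ (hψ _).ne']
  refine mul_le_mul_of_nonneg_left (sq_le_sq.2 ?_) (sq_nonneg _)
  refine (abs_max_sub_max_le_max _ _ _ _).trans (max_le (by simp) ?_)
  exact (abs_min_sub_min_le_max _ _ _ _).trans (max_le (by simp) le_rfl)

/-- A critical form has a null sequence dominated by its ground state. -/
theorem IsCritical.exists_null_sequence (hG : G.Connected) (h : IsCritical G q)
    (hψ : IsGroundState G q o ψ) :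
    ∃ e : ℕ → X →₀ ℝ, (∀ n x, 0 ≤ e n x ∧ e n x ≤ ψ x) ∧ (∀ n, e n o = 1) ∧
      Tendsto (fun n => quadForm G q (e n)) atTop (𝓝 0) := by
  have hpos := hψ.pos hG
  have hrep := hasSum_edgeDiff_sq hpos hψ.2.1 hψ.2.2.1
  choose φ hφ1 hφ using fun n : ℕ => h.exists_small o (Nat.one_div_pos_of_nat (α := ℝ) (n := n))
  refine ⟨fun n => truncate ψ (φ n), fun n x => ?_, fun n => ?_, ?_⟩
  · rw [truncate_apply]
    refine ⟨mul_nonneg (le_max_left _ _) (hpos x).le, ?_⟩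
    exact mul_le_of_le_one_left (hpos x).le (max_le zero_le_one (min_le_left _ _))
  · simp [truncate_apply, hφ1, hψ.2.2.2]
  · refine squeeze_zero (fun n => h.1 _) (fun n => ?_) tendsto_one_div_add_atTop_nhds_zero_nat
    exact (hasSum_le (edgeDiff_truncate_sq_le hpos (φ n)) (hrep _) (hrep _)).trans (hφ n).le

/-- The ground state of a critical form is unique up to a factor. -/
theorem IsCritical.groundState_unique (hG : G.Connected) (h : IsCritical G q)
    (hψ : IsGroundState G q o ψ) {o' : X} {ψ' : X → ℝ} (hψ' : IsGroundState G q o' ψ') (x : X) :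
    ψ x = ψ' x / ψ' o := by
  -- One null sequence serves both ground states, so its pointwise limit identifies them.
  obtain ⟨e, -, heo, he⟩ := h.exists_null_sequence hG hψ
  have h1 := tendsto_of_edgeDiff_tendsto_zero hG (hψ.pos hG)
    (tendsto_edgeDiff_of_quadForm (hψ.pos hG) hψ.2.1 hψ.2.2.1 he) heo x
  have h2 := tendsto_of_edgeDiff_tendsto_zero hG (hψ'.pos hG)
    (tendsto_edgeDiff_of_quadForm (hψ'.pos hG) hψ'.2.1 hψ'.2.2.1 he) heo x
  rw [hψ.2.2.2, div_one] at h1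
  exact tendsto_nhds_unique h1 h2

/-! ### The extended space and the closure -/

theorem ellTwo_const_mul {f : X → ℝ} (hf : f ∈ ellTwo w) (c : ℝ) :
    (fun x => c * f x) ∈ ellTwo w :=
  (Summable.mul_left (c ^ 2) hf).congr fun x => by ring

theorem ExtApprox.quadForm_cauchy {φ : ℕ → X →₀ ℝ} {f : X → ℝ} (h : ExtApprox G q o φ f) :
    ∀ ε > 0, ∃ N, ∀ m ≥ N, ∀ n ≥ N, quadForm G q (φ m - φ n) < ε := by
  intro ε hε
  obtain ⟨N, hN⟩ := h.1 (√ε) (Real.sqrt_pos.2 hε)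
  refine ⟨N, fun m hm n hn => lt_of_not_ge fun hle => (hN m hm n hn).not_ge ?_⟩
  exact Real.sqrt_le_sqrt (hle.trans (le_add_of_nonneg_right (sq_nonneg _)))

section GroundState

variable (hw : ∀ x, 0 ≤ w x) (hψ : ∀ x, 0 < ψ x) (hF : ψ ∈ formalDomain G)
  (hH : ∀ x, formalOp G (q - w) ψ x = 0)

include hw

theorem sqrt_weight_mul_sq (f : X → ℝ) (x : X) : (√(w x) * f x) ^ 2 = w x * f x ^ 2 := by
  rw [mul_pow, Real.sq_sqrt (hw x)]

/-- The squared form norm of `h - w` in `ℓ²(X,w)` is `h` itself, so the closure and `D_{h,o}` share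
the same Cauchy estimate. -/
theorem FormApprox.quadForm_cauchy {φ : ℕ → X →₀ ℝ} {f : X → ℝ}
    (h : FormApprox G (q - w) w φ f) :
    ∀ ε > 0, ∃ N, ∀ m ≥ N, ∀ n ≥ N, quadForm G q (φ m - φ n) < ε := by
  intro ε hε
  obtain ⟨N, hN⟩ := h.2.1 (√ε) (Real.sqrt_pos.2 hε)
  refine ⟨N, fun m hm n hn => lt_of_not_ge fun hle => (hN m hm n hn).not_ge ?_⟩
  rw [normF, normW_sq hw, ← quadForm_eq_sub_add]
  exact Real.sqrt_le_sqrt hle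

theorem FormApprox.tendsto_apply {φ : ℕ → X →₀ ℝ} {f : X → ℝ} {x : X}
    (h : FormApprox G q w φ f) (hx : 0 < w x) :
    Tendsto (fun n => φ n x) atTop (𝓝 (f x)) := by
  have hs : ∀ n, Summable fun x => w x * (φ n x - f x) ^ 2 := fun n => by
    refine Summable.of_nonneg_of_le (fun x => mul_nonneg (hw x) (sq_nonneg _)) (fun x => ?_)
      (((summable_weight_sq w (φ n)).mul_left 2).add (Summable.mul_left 2 h.1))
    nlinarith [mul_nonneg (hw x) (sq_nonneg (φ n x + f x))]
  have h1 : Tendsto (fun n => √(w x) * (φ n x - f x)) atTop (𝓝 0) := by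
    refine squeeze_zero_norm (fun n => ?_) h.2.2
    rw [Real.norm_eq_abs, normW]
    refine Real.abs_le_sqrt ?_
    rw [mul_pow, Real.sq_sqrt (hw x)]
    exact (hs n).le_tsum x fun y _ => mul_nonneg (hw y) (sq_nonneg _)
  have h2 := (h1.div_const √(w x)).add_const (f x)
  rw [zero_div, zero_add] at h2
  refine h2.congr fun n => ?_
  rw [mul_div_cancel_left₀ _ (Real.sqrt_pos.2 hx).ne', sub_add_cancel]

include hψ hF hH

/-- Both parts of `h` are nonnegative, so each is controlled by `h`. -/
theorem isSqCauchy_of_quadForm {φ : ℕ → X →₀ ℝ}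
    (h : ∀ ε > 0, ∃ N, ∀ m ≥ N, ∀ n ≥ N, quadForm G q (φ m - φ n) < ε) :
    IsSqCauchy (fun n => edgeDiff G ψ (φ n)) ∧ IsSqCauchy (fun n x => √(w x) * φ n x) := by
  have hrep := hasSum_edgeDiff_sq hψ hF hH
  have hW : ∀ f : X → ℝ, 0 ≤ ∑' x, w x * f x ^ 2 := fun f =>
    tsum_nonneg fun x => mul_nonneg (hw x) (sq_nonneg _)
  refine ⟨⟨fun n => (hrep (φ n)).summable, fun ε hε => ?_⟩, ⟨fun n => ?_, fun ε hε => ?_⟩⟩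
  · obtain ⟨N, hN⟩ := h ε hε
    refine ⟨N, fun m hm n hn => ?_⟩
    have h1 := hN m hm n hn
    rw [quadForm_eq_sub_add q w, ← (hrep (φ m - φ n)).tsum_eq] at h1
    simp only [← edgeDiff_sub, ← Finsupp.coe_sub]
    linarith [hW (φ m - φ n : X →₀ ℝ)]
  · simpa only [sqrt_weight_mul_sq hw] using summable_weight_sq w (φ n)
  · obtain ⟨N, hN⟩ := h ε hε
    refine ⟨N, fun m hm n hn => ?_⟩
    have h1 := hN m hm n hn
    rw [quadForm_eq_sub_add q w] at h1
    have h2 := (hrep (φ m - φ n)).nonneg fun _ => sq_nonneg _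
    simp only [← mul_sub, ← Finsupp.sub_apply, sqrt_weight_mul_sq hw]
    linarith

theorem extSpace_subset_ellTwo {f : X → ℝ} (hf : f ∈ extSpace G q o) : f ∈ ellTwo w := by
  obtain ⟨φ, hφ⟩ := hf
  have h := (isSqCauchy_of_quadForm hw hψ hF hH (hφ.quadForm_cauchy)).2.summable_sq
    fun x => (hφ.2 x).const_mul _
  simpa only [sqrt_weight_mul_sq hw, ellTwo, Set.mem_ofPred_eq] using h

/-- The closed form is given by the ground state representation on the extended space. -/
theorem extForm_eq {f : X → ℝ} (hf : f ∈ extSpace G q o) :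
    (Summable fun p => edgeDiff G ψ f p ^ 2) ∧
      extForm G q o f = ∑' p, edgeDiff G ψ f p ^ 2 + ∑' x, w x * f x ^ 2 := by
  have hf' : ∃ φ, ExtApprox G q o φ f := hf
  have hφ := hf'.choose_spec
  rw [extForm, dif_pos hf']
  set φ := hf'.choose
  obtain ⟨h1, h2⟩ := isSqCauchy_of_quadForm hw hψ hF hH (hφ.quadForm_cauchy)
  have hl1 := tendsto_edgeDiff_of_tendsto (G := G) (ψ := ψ) hφ.2
  have hl2 := fun x => (hφ.2 x).const_mul √(w x)
  refine ⟨h1.summable_sq hl1, Tendsto.limUnder_eq ?_⟩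
  have h3 := (h1.tendsto_tsum_mul h1 hl1 hl1).add (h2.tendsto_tsum_mul h2 hl2 hl2)
  simp only [← sq, sqrt_weight_mul_sq hw] at h3
  refine h3.congr fun n => ?_
  rw [quadForm_eq_sub_add q w, (hasSum_edgeDiff_sq hψ hF hH (φ n)).tsum_eq]

/-- Forms of approximating sequences are given by the ground state representation. -/
theorem closureForm_eq (hpos : ∀ x, 0 < w x) {f g : X → ℝ}
    (hf : f ∈ closureDomain G (q - w) w) (hg : g ∈ closureDomain G (q - w) w) :
    closureForm G (q - w) w f g = ∑' p, edgeDiff G ψ f p * edgeDiff G ψ g p := by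
  have hfg : (∃ φ, FormApprox G (q - w) w φ f) ∧ ∃ η, FormApprox G (q - w) w η g := ⟨hf, hg⟩
  rw [closureForm, dif_pos hfg]
  have h1 := hfg.1.choose_spec
  have h2 := hfg.2.choose_spec
  refine Tendsto.limUnder_eq ?_
  refine (IsSqCauchy.tendsto_tsum_mul
    (isSqCauchy_of_quadForm hw hψ hF hH (h1.quadForm_cauchy hw)).1
    (isSqCauchy_of_quadForm hw hψ hF hH (h2.quadForm_cauchy hw)).1
    (tendsto_edgeDiff_of_tendsto fun x => h1.tendsto_apply hw (hpos x))
    (tendsto_edgeDiff_of_tendsto fun x => h2.tendsto_apply hw (hpos x))).congr fun n => ?_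
  exact (hasSum_edgeDiff_mul hψ hF hH _ _).tsum_eq

end GroundState

theorem edgeDiff_self (hψ : ∀ x, 0 < ψ x) (p : X × X) : edgeDiff G ψ ψ p = 0 := by
  simp [edgeDiff, (hψ _).ne']

/-! ### Convergence of dominated null sequences -/

section NullSequence

variable {e : ℕ → X →₀ ℝ} (hw : ∀ x, 0 ≤ w x) (hψw : ψ ∈ ellTwo w)
  (he : ∀ n x, 0 ≤ e n x ∧ e n x ≤ ψ x) (hlim : ∀ x, Tendsto (fun n => e n x) atTop (𝓝 (ψ x)))

include hw hψw he hlim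

/-- A sequence dominated by its square summable pointwise limit converges in `ℓ²`. -/
theorem tendsto_tsum_weight_sub_sq :
    Tendsto (fun n => ∑' x, w x * (e n x - ψ x) ^ 2) atTop (𝓝 0) := by
  have h := tendsto_tsum_of_dominated_convergence (𝓕 := atTop)
    (f := fun n x => w x * (e n x - ψ x) ^ 2) (g := fun _ => 0) (bound := fun x => w x * ψ x ^ 2)
    hψw (fun x => ?_) (Eventually.of_forall fun n x => ?_)
  · simpa using h
  · simpa using (((hlim x).sub_const (ψ x)).pow 2).const_mul (w x)
  · rw [Real.norm_of_nonneg (mul_nonneg (hw x) (sq_nonneg _))]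
    have := he n x
    exact mul_le_mul_of_nonneg_left (by nlinarith) (hw x)

/-- A null sequence dominated by its square summable limit is Cauchy in the form norm. -/
theorem quadForm_cauchy_of_null (hψ : ∀ x, 0 < ψ x) (hF : ψ ∈ formalDomain G)
    (hH : ∀ x, formalOp G (q - w) ψ x = 0)
    (hnull : Tendsto (fun n => quadForm G (q - w) (e n)) atTop (𝓝 0)) :
    ∀ ε > 0, ∃ N, ∀ m ≥ N, ∀ n ≥ N, quadForm G q (e m - e n) < ε := by
  intro ε hε
  have hs : ∀ n, Summable fun x => w x * (e n x - ψ x) ^ 2 := fun n => by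
    refine Summable.of_nonneg_of_le (fun x => mul_nonneg (hw x) (sq_nonneg _)) (fun x => ?_) hψw
    have := he n x
    exact mul_le_mul_of_nonneg_left (by nlinarith) (hw x)
  -- The edge part and the weight part of `e m - e n` each cost twice two such terms, that is `ε /
  -- 2`.
  have h1 := (hnull.eventually_lt_const (show (0 : ℝ) < ε / 8 by positivity)).and
    ((tendsto_tsum_weight_sub_sq hw hψw he hlim).eventually_lt_const
      (show (0 : ℝ) < ε / 8 by positivity))
  obtain ⟨N, hN⟩ := eventually_atTop.1 h1
  refine ⟨N, fun m hm n hn => ?_⟩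
  obtain ⟨hm1, hm2⟩ := hN m hm
  obtain ⟨hn1, hn2⟩ := hN n hn
  have h2 : ∑' x, w x * (e m - e n) x ^ 2
      ≤ 2 * ∑' x, w x * (e m x - ψ x) ^ 2 + 2 * ∑' x, w x * (e n x - ψ x) ^ 2 := by
    refine hasSum_le (fun x => ?_) (summable_weight_sq w (e m - e n)).hasSum
      (((hs m).hasSum.mul_left 2).add ((hs n).hasSum.mul_left 2))
    rw [Finsupp.sub_apply]
    nlinarith [mul_nonneg (hw x) (sq_nonneg (e m x - ψ x + (e n x - ψ x)))]
  rw [quadForm_eq_sub_add q w]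
  linarith [quadForm_sub_le hψ hF hH (e m) (e n)]

end NullSequence

/-! ### Rayleigh quotients -/

/-- The infimum of the Rayleigh quotients is `1` if `h - w` is critical. -/
theorem isGLB_rayleighSet (hG : G.Connected) (hw : IsPositive w) (h : IsCritical G (q - w))
    (hψ : IsGroundState G (q - w) o ψ) : IsGLB (rayleighSet G q w) 1 := by
  obtain ⟨e, -, heo, hnull⟩ := h.exists_null_sequence hG hψ
  have hlim := tendsto_of_edgeDiff_tendsto_zero hG (hψ.pos hG)
    (tendsto_edgeDiff_of_quadForm (hψ.pos hG) hψ.2.1 hψ.2.2.1 hnull) heo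
  simp only [hψ.2.2.2, div_one] at hlim
  have hquot : ∀ φ : X →₀ ℝ, normW w φ ≠ 0 →
      quadForm G q φ / normW w φ ^ 2 = quadForm G (q - w) φ / normW w φ ^ 2 + 1 := by
    intro φ hφ
    rw [quadForm_eq_sub_add q w, ← normW_sq hw.1, add_div, div_self (pow_ne_zero 2 hφ)]
  refine ⟨?_, fun c hc => ?_⟩
  · rintro r ⟨φ, hφ, rfl⟩
    rw [hquot φ hφ]
    exact le_add_of_nonneg_left (div_nonneg (h.1 φ) (sq_nonneg _))
  · obtain ⟨x, hx⟩ := Function.ne_iff.1 hw.2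
    have hx : 0 < w x := lt_of_le_of_ne (hw.1 x) (Ne.symm hx)
    -- Since `‖e n‖_w` need not converge, it is bounded below by the single term at `x`, whose limit
    -- `w x * ψ x ^ 2` is positive.
    have hev : ∀ᶠ n in atTop, 0 < w x * e n x ^ 2 ∧
        c ≤ quadForm G (q - w) (e n) / (w x * e n x ^ 2) + 1 := by
      filter_upwards [(hlim x).eventually_const_lt (hψ.pos hG x)] with n hn
      have hpos : 0 < w x * e n x ^ 2 := by positivity
      have hle : w x * e n x ^ 2 ≤ normW w (e n) ^ 2 := by
        rw [normW_sq hw.1]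
        exact (summable_weight_sq w (e n)).le_tsum x fun y _ => mul_nonneg (hw.1 y) (sq_nonneg _)
      have hne : normW w (e n) ≠ 0 := fun h0 => by
        rw [h0] at hle
        norm_num at hle
        linarith
      refine ⟨hpos, (hc ⟨e n, hne, rfl⟩).trans ?_⟩
      rw [hquot _ hne]
      gcongr
      exact h.1 _
    have ht := (hnull.div (((hlim x).pow 2).const_mul (w x))
      (mul_pos hx (pow_pos (hψ.pos hG x) 2)).ne').add_const 1
    rw [zero_div, zero_add] at ht
    exact ge_of_tendsto ht (hev.mono fun n hn => hn.2)

/-- Minimizers of the Rayleigh quotient are multiples of the ground state. -/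
theorem AttainsRayleigh.groundState_mem_ellTwo (hG : G.Connected) (hw : IsPositive w)
    (h : IsCritical G (q - w)) (hψ : IsGroundState G (q - w) o ψ) {v : X → ℝ}
    (hv : AttainsRayleigh G q w o v) : ψ ∈ ellTwo w := by
  have hpos := hψ.pos hG
  obtain ⟨⟨hv1, hv2⟩, hv3, hv4⟩ := hv
  obtain ⟨hs, hval⟩ := extForm_eq hw.1 hpos hψ.2.1 hψ.2.2.1 hv1
  have h1 := hv4.unique (isGLB_rayleighSet hG hw h hψ)
  -- Quotient 1 means that the edge part of `v` vanishes.
  rw [div_eq_one_iff_eq (pow_ne_zero 2 hv3), hval, normW_sq hw.1, add_eq_right] at h1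
  have h2 := hs.hasSum_iff.2 h1
  rw [hasSum_zero_iff_of_nonneg fun p => sq_nonneg _] at h2
  have h3 := eq_of_edgeDiff_eq_zero (o := o) hG hpos fun p => pow_eq_zero_iff two_ne_zero |>.1
    (congrFun h2 p)
  have h4 : ∀ x, v x = v o * ψ x := fun x => by
    have := h3 x
    rwa [hψ.2.2.2, div_one, div_eq_iff (hpos x).ne'] at this
  have h5 : v o ≠ 0 := fun h0 => hv3 <| by
    have h6 : v = 0 := funext fun x => by rw [h4, h0, zero_mul, Pi.zero_apply]
    simp [normW, h6]
  refine (ellTwo_const_mul hv2 (v o)⁻¹).congr fun x => ?_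
  beta_reduce
  rw [h4 x, inv_mul_cancel_left₀ h5]

end

end GraphCriticality

/-! ### The equivalences -/

open GraphCriticality in
theorem mainTheorem6 {X : Type*} [Infinite X] (G : GraphCriticality.WGraph X)
    (hG : G.Connected) (q w : X → ℝ) (o : X) (hw : GraphCriticality.IsPositive w)
    (hcrit : GraphCriticality.IsCritical G (q - w)) (ψ : X → ℝ)
    (hψ : GraphCriticality.IsGroundState G (q - w) o ψ) :
    List.TFAE [
      GraphCriticality.IsPositiveCritical G (q - w) w,
      ψ ∈ GraphCriticality.ellTwo w,
      ψ ∈ GraphCriticality.extSpace G q o,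
      ψ ∈ GraphCriticality.extSpace G q o ∩ GraphCriticality.ellTwo w,
      ∃ v : X → ℝ, GraphCriticality.AttainsRayleigh G q w o v,
      GraphCriticality.AttainsRayleigh G q w o ψ] ∧
    ((∀ x, 0 < w x) →
      (ψ ∈ GraphCriticality.ellTwo w ↔
        GraphCriticality.IsEigenfunction G (q - w) w 0 ψ)) := by
  have hpos := hψ.pos hG
  obtain ⟨e, he, heo, hnull⟩ := hcrit.exists_null_sequence hG hψ
  have hlim := tendsto_of_edgeDiff_tendsto_zero hG hpos
    (tendsto_edgeDiff_of_quadForm hpos hψ.2.1 hψ.2.2.1 hnull) heo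
  simp only [hψ.2.2.2, div_one] at hlim
  have hcauchy := fun h2 : ψ ∈ ellTwo w =>
    quadForm_cauchy_of_null hw.1 h2 he hlim hpos hψ.2.1 hψ.2.2.1 hnull
  refine ⟨?_, fun hwpos => ⟨fun h2 => ?_, fun h => ?_⟩⟩
  · tfae_have 1 → 2 := by
      rintro ⟨-, o', ψ', hψ', h⟩
      refine (ellTwo_const_mul h (ψ' o)⁻¹).congr fun x => ?_
      beta_reduce
      rw [hcrit.groundState_unique hG hψ hψ' x, inv_mul_eq_div]
    tfae_have 2 → 1 := fun h => ⟨hcrit, o, ψ, hψ, h⟩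
    tfae_have 2 → 3 := by
      intro h2
      refine ⟨e, fun ε hε => ?_, hlim⟩
      obtain ⟨N, hN⟩ := hcauchy h2 (ε ^ 2) (by positivity)
      refine ⟨N, fun m hm n hn => ?_⟩
      -- The term at `o` drops out because `e n o = 1` for all `n`.
      rw [normO, Real.sqrt_lt' hε, Finsupp.sub_apply, heo, heo]
      simpa using hN m hm n hn
    tfae_have 3 → 4 := fun h => ⟨h, extSpace_subset_ellTwo hw.1 hpos hψ.2.1 hψ.2.2.1 h⟩
    tfae_have 4 → 6 := by
      intro h
      obtain ⟨x, hx⟩ := Function.ne_iff.1 hw.2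
      have hx : 0 < w x := lt_of_le_of_ne (hw.1 x) (Ne.symm hx)
      have hnorm : 0 < ∑' x, w x * ψ x ^ 2 :=
        h.2.tsum_pos (fun x => mul_nonneg (hw.1 x) (sq_nonneg _)) x
          (mul_pos hx (pow_pos (hpos x) 2))
      refine ⟨h, (Real.sqrt_pos.2 hnorm).ne', ?_⟩
      rw [(extForm_eq hw.1 hpos hψ.2.1 hψ.2.2.1 h.1).2, normW_sq hw.1]
      simpa [edgeDiff_self hpos, div_self hnorm.ne'] using isGLB_rayleighSet hG hw hcrit hψ
    tfae_have 6 → 5 := fun h => ⟨ψ, h⟩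
    tfae_have 5 → 2 := fun ⟨v, hv⟩ => hv.groundState_mem_ellTwo hG hw hcrit hψ
    tfae_finish
  · have hdom : ψ ∈ closureDomain G (q - w) w := by
      refine ⟨e, h2, fun ε hε => ?_, ?_⟩
      · obtain ⟨N, hN⟩ := hcauchy h2 (ε ^ 2) (by positivity)
        refine ⟨N, fun m hm n hn => ?_⟩
        rw [normF, Real.sqrt_lt' hε, normW_sq hw.1, ← quadForm_eq_sub_add]
        exact hN m hm n hn
      · have h := (Real.continuous_sqrt.tendsto 0).comp
          (tendsto_tsum_weight_sub_sq hw.1 h2 he hlim)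
        rw [Real.sqrt_zero] at h
        exact h
    refine ⟨hψ.1.2, hdom, by simp [ellTwo, summable_zero], fun k hk => ?_⟩
    rw [closureForm_eq hw.1 hpos hψ.2.1 hψ.2.2.1 hwpos hdom hk]
    simp [edgeDiff_self hpos, innerW]
  · obtain ⟨φ, hφ⟩ := h.2.1
    exact hφ.1
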